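/- Let $\Lambda$ be a locally compact, $\sigma$-compact metric space with its Borel $\sigma$-algebra. Let $\Gamma_\Lambda$ be the set of configurations on $\Lambda$, i.e. of subsets $\omega\subset\Lambda$ such that $\omega\cap K$ is finite for every compact $K\subset\Lambda$. Identify $\omega$ with the measure $\sum_{x\in\omega}\varepsilon_x$, where $\varepsilon_x$ is the Dirac measure at $x$, and equip $\Gamma_\Lambda$ with the vague topology (the weakest topology for which $\omega\mapsto\int f\,d\omega=\sum_{x\in\omega}f(x)$ is continuous for every continuous compactly supported $f:\Lambda\to\mathbb R$) and its Borel $\sigma$-algebra $\mathcal B(\Gamma_\Lambda)$. For a finite diffuse (i.e. atomless) Borel measure $\sigma$ on $\Lambda$, let $\mu_\sigma$ be the Poisson measure of intensity $\sigma$, the probability measure on $\Gamma_\Lambda$ characterized by $$\mathbb E_{\mu_\sigma}\Big[\exp\Big(\int_\Lambda f\,d\omega\Big)\Big]=\exp\Big\{\int_\Lambda (e^f-1)\,d\sigma\Big\}$$ for all continuous compactly supported $f:\Lambda\to\mathbb R$. For $F:\Gamma_\Lambda\to\mathbb R$ let $\nabla^\sharp_xF(\omega)=F(\omega+\varepsilon_x)-F(\omega)$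 (defined for $x\notin\omega$, hence for $\sigma$-almost every $x$), for $A\in\mathcal B(\Gamma_\Lambda)$ let $$\mu_\sigma(\partial A):=\mathbb E_{\mu_\sigma}\Big[\int_\Lambda|\nabla^\sharp_x\mathbf 1_A|\,d\sigma(x)\Big],$$ and define the isoperimetric constant $$h_{\mu_\sigma}:=\inf_{A\in\mathcal B(\Gamma_\Lambda),\;0<\mu_\sigma(A)<1}\frac{\mu_\sigma(\partial A)}{\mu_\sigma(A)\,(1-\mu_\sigma(A))}.$$ Then, for every finite diffuse Borel measure $\sigma\neq 0$ on $\Lambda$, $$1\le h_{\mu_\sigma}\le\frac{\sigma(\Lambda)}{1-e^{-\sigma(\Lambda)}}.$$ In particular, $h_{\mu_\sigma}\to1$ as $\sigma(\Lambda)\to0$, $\sigma(\Lambda)>0$, along the finite diffuse Borel measures $\sigma$ on $\Lambda$. -/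

import Mathlib

open MeasureTheory Filter Topology
open scoped CompactlySupported ENNReal

/-- The configuration space of `Λ`: the subsets `ω` of `Λ` that meet every compact set in a
finite set. -/
structure Configuration (Λ : Type*) [TopologicalSpace Λ] where
  carrier : Set Λ
  finite_inter : ∀ K : Set Λ, IsCompact K → (carrier ∩ K).Finite

namespace Configuration

variable {Λ : Type*} [TopologicalSpace Λ]

/-- The integral `∫ f dω = ∑_{x ∈ ω} f x`; only finitely many terms are nonzero. -/
noncomputable def integral (ω : Configuration Λ) (f : C_c(Λ, ℝ)) : ℝ :=
  ∑ᶠ x ∈ ω.carrier, f x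

/-- The vague topology: the weakest one for which `ω ↦ ∫ f dω` is continuous for every continuous
`f` with compact support. -/
noncomputable instance : TopologicalSpace (Configuration Λ) :=
  ⨅ f : C_c(Λ, ℝ), TopologicalSpace.induced (fun ω => ω.integral f) inferInstance

noncomputable instance : MeasurableSpace (Configuration Λ) := borel (Configuration Λ)

instance : BorelSpace (Configuration Λ) := ⟨rfl⟩

/-- The configuration `ω + ε_x`, i.e. `ω ∪ {x}`. (For `x ∈ ω` the measure `ω + ε_x` is not simple,
hence not a configuration; here `ω.add x = ω` then. As `ω` is countable, this concerns a set of
points `x` that is negligible for every diffuse measure.) -/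
def add (ω : Configuration Λ) (x : Λ) : Configuration Λ where
  carrier := insert x ω.carrier
  finite_inter K hK :=
    ((ω.finite_inter K hK).union (Set.finite_singleton x)).subset (by
      rintro y ⟨rfl | hy, hyK⟩
      · exact Or.inr rfl
      · exact Or.inl ⟨hy, hyK⟩)

/-- The discrete gradient `∇♯_x F (ω) = F (ω + ε_x) - F ω`. -/
def discreteGradient (F : Configuration Λ → ℝ) (ω : Configuration Λ) (x : Λ) : ℝ :=
  F (ω.add x) - F ω

end Configuration

section Poisson

variable {Λ : Type*} [TopologicalSpace Λ] [MeasurableSpace Λ]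

/-- `μ` is a Poisson measure of intensity `σ`: a probability measure on the configuration space
with `E_μ[exp (∫ f dω)] = exp (∫ (e^f - 1) dσ)` for all continuous `f` with compact support.
(The right-hand side is nonzero, so the equation forces `exp (∫ f dω)` to be `μ`-integrable.) -/
def IsPoissonMeasure (σ : Measure Λ) (μ : Measure (Configuration Λ)) : Prop :=
  IsProbabilityMeasure μ ∧
    ∀ f : C_c(Λ, ℝ),
      ∫ ω, Real.exp (ω.integral f) ∂μ = Real.exp (∫ x, (Real.exp (f x) - 1) ∂σ)

open Classical in
/-- The Poisson measure `μ_σ` of intensity `σ` (the value is `0` if there is none). -/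
noncomputable def poissonMeasure (σ : Measure Λ) : Measure (Configuration Λ) :=
  if h : ∃ μ, IsPoissonMeasure σ μ then h.choose else 0

/-- The surface measure `μ_σ(∂A) = E_{μ_σ}[∫ |∇♯_x 1_A| dσ(x)]`. -/
noncomputable def surfaceMeasure (σ : Measure Λ) (A : Set (Configuration Λ)) : ℝ≥0∞ :=
  ∫⁻ ω, ∫⁻ x,
    ENNReal.ofReal |Configuration.discreteGradient (A.indicator fun _ => (1 : ℝ)) ω x| ∂σ
      ∂(poissonMeasure σ)

/-- The isoperimetric constant `h_{μ_σ} = inf μ_σ(∂A) / (μ_σ(A) (1 - μ_σ(A)))`, the infimum over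
the Borel sets `A` with `0 < μ_σ(A) < 1`. In this normalization it is the best constant `h` in
`h E|F - E F| ≤ 2 E ∫ |∇♯_x F| dσ(x)`, as `E|1_A - μ_σ(A)| = 2 μ_σ(A) (1 - μ_σ(A))`. -/
noncomputable def isoperimetricConstant (σ : Measure Λ) : ℝ≥0∞ :=
  ⨅ (A : Set (Configuration Λ)) (_ : MeasurableSet A) (_ : 0 < poissonMeasure σ A)
    (_ : poissonMeasure σ A < 1),
    surfaceMeasure σ A / (poissonMeasure σ A * (1 - poissonMeasure σ A))

end Poisson

set_option linter.unusedSectionVars false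

/-! The lower bound is an `L¹` Poincaré inequality (`meanDifference_le`): for independent Poisson
samples `a`, `b` and `F` of oscillation at most 1, `E|F(a) - F(b)| ≤ 2 E ∫ |∇♯F| dσ`. For an
indicator the left side is `2 μ(A) (1 - μ(A))`. With `s = σ(Λ)`, comparing `F` with its value at the
empty configuration proves the inequality up to an error `2 s²`, as two or more points have
probability at most `s²`. A Poisson sample of intensity `σ` is the sum of two independent samples of
intensity `σ/2`, and the triangle inequality splits the mean difference accordingly. After `k`
halvings the error is `2⁻ᵏ · 2 s²`; let `k → ∞`. Configurations sharing a point have no sum among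
configurations, so this is done for their images in `C_c(Λ, ℝ) → ℝ`. The passage requires the Borel
sets to be generated by the integrals, and `poissonMeasure` to be an explicit mixture, via
uniqueness of Laplace transforms. The upper bound tests `A = {∅}`, where `μ(A) = e⁻ˢ` and `μ(∂A) = s
e⁻ˢ`. -/

namespace Configuration

/-! ### Integration of test functions against configurations. -/

section Integral

variable {Λ : Type*} [TopologicalSpace Λ]

lemma finite_inter_support (ω : Configuration Λ) (f : C_c(Λ, ℝ)) :
    (ω.carrier ∩ Function.support f).Finite :=
  (ω.finite_inter _ f.hasCompactSupport).subset
    (Set.inter_subset_inter_right _ (subset_tsupport f))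

lemma integral_map_add (ω : Configuration Λ) (f g : C_c(Λ, ℝ)) :
    ω.integral (f + g) = ω.integral f + ω.integral g :=
  finsum_mem_add_distrib' (ω.finite_inter_support f) (ω.finite_inter_support g)

lemma integral_map_smul (ω : Configuration Λ) (r : ℝ) (f : C_c(Λ, ℝ)) :
    ω.integral (r • f) = r * ω.integral f :=
  ((AddMonoidHom.mulLeft r).map_finsum_mem' (f := f) (ω.finite_inter_support f)).symm

lemma integral_map_sum {ι : Type*} (ω : Configuration Λ) (s : Finset ι) (f : ι → C_c(Λ, ℝ)) :
    ω.integral (∑ i ∈ s, f i) = ∑ i ∈ s, ω.integral (f i) := by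
  classical
  induction s using Finset.induction_on with
  | empty => simp [integral]
  | insert i s hi ih => rw [Finset.sum_insert hi, Finset.sum_insert hi, integral_map_add, ih]

lemma integral_nonneg (ω : Configuration Λ) {f : C_c(Λ, ℝ)} (hf : ∀ x, 0 ≤ f x) :
    0 ≤ ω.integral f :=
  finsum_nonneg fun x => finsum_nonneg fun _ => hf x

lemma integral_mono (ω : Configuration Λ) {f g : C_c(Λ, ℝ)} (h : ∀ x, f x ≤ g x) :
    ω.integral f ≤ ω.integral g := by
  have h1 : g = f + (g + (-1 : ℝ) • f) := by ext x; simp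
  rw [h1, integral_map_add]
  have := ω.integral_nonneg (f := g + (-1 : ℝ) • f) fun x => by
    simpa [← sub_eq_add_neg] using h x
  linarith

lemma abs_integral_sub_le (ω : Configuration Λ) {f g φ : C_c(Λ, ℝ)} {δ : ℝ}
    (h : ∀ x, |f x - g x| ≤ δ * φ x) :
    |ω.integral f - ω.integral g| ≤ δ * ω.integral φ := by
  have h1 : ω.integral f ≤ ω.integral (g + δ • φ) := ω.integral_mono fun x => by
    have := (abs_le.1 (h x)).2
    simp only [CompactlySupportedContinuousMap.add_apply,
      CompactlySupportedContinuousMap.smul_apply, smul_eq_mul]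
    linarith
  have h2 : ω.integral g ≤ ω.integral (f + δ • φ) := ω.integral_mono fun x => by
    have := (abs_le.1 (h x)).1
    simp only [CompactlySupportedContinuousMap.add_apply,
      CompactlySupportedContinuousMap.smul_apply, smul_eq_mul]
    linarith
  rw [integral_map_add, integral_map_smul] at h1 h2
  exact abs_le.2 ⟨by linarith, by linarith⟩

lemma le_integral (ω : Configuration Λ) {f : C_c(Λ, ℝ)} (hf : ∀ x, 0 ≤ f x) {x : Λ}
    (hx : x ∈ ω.carrier) : f x ≤ ω.integral f := by
  rcases (hf x).eq_or_lt with h | h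
  · rw [← h]
    exact ω.integral_nonneg hf
  · rw [integral, finsum_mem_eq_sum_of_inter_support_eq f
      (t := (ω.finite_inter_support f).toFinset) (by ext; simp)]
    exact Finset.single_le_sum (f := f) (fun i _ => hf i) (by simpa using ⟨hx, h.ne'⟩)

open Classical in
lemma integral_add_point (ω : Configuration Λ) (x : Λ) (f : C_c(Λ, ℝ)) :
    (ω.add x).integral f = ω.integral f + if x ∈ ω.carrier then 0 else f x := by
  split_ifs with h
  · simp [integral, add, Set.insert_eq_of_mem h]
  · rw [integral, add, finsum_mem_insert' f h (ω.finite_inter_support f), add_comm, integral]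

/-- The family of all integrals of a configuration. -/
noncomputable def evaluation (ω : Configuration Λ) : C_c(Λ, ℝ) → ℝ := fun f => ω.integral f

lemma isInducing_evaluation : IsInducing (evaluation (Λ := Λ)) :=
  inducing_iInf_to_pi fun (f : C_c(Λ, ℝ)) (ω : Configuration Λ) => ω.integral f

lemma continuous_integral (f : C_c(Λ, ℝ)) :
    Continuous fun ω : Configuration Λ => ω.integral f :=
  (continuous_apply f).comp isInducing_evaluation.continuous

/-- The configuration without points. -/
protected def empty : Configuration Λ := ⟨∅, by simp⟩

lemma evaluation_empty : (Configuration.empty : Configuration Λ).evaluation = 0 := by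
  ext f; simp [evaluation, integral, Configuration.empty]

end Integral

/-! ### The Borel structure of the configuration space. -/

section Measurability

variable {Λ : Type*} [MetricSpace Λ] [SigmaCompactSpace Λ] [LocallyCompactSpace Λ]

lemma exists_cutoff (K : Set Λ) (hK : IsCompact K) :
    ∃ φ : C_c(Λ, ℝ), (∀ x ∈ K, φ x = 1) ∧ ∀ x, 0 ≤ φ x := by
  obtain ⟨φ, h1, h2, -, h3⟩ := exists_continuousMap_one_of_isCompact_subset_isOpen hK isOpen_univ
    (Set.subset_univ _)
  exact ⟨⟨φ, h2⟩, fun x hx => h1 hx, fun x => (h3 x).1⟩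

variable (Λ) in
/-- Countably many integrals already determine the vague topology. -/
lemma exists_countable_family : ∃ d : ℕ × Option ℕ → C_c(Λ, ℝ),
    ∀ (X : Type _) [TopologicalSpace X] (c : X → Configuration Λ),
      (∀ i, Continuous fun x => (c x).integral (d i)) →
        ∀ f : C_c(Λ, ℝ), Continuous fun x => (c x).integral f := by
  let K := CompactExhaustion.choice Λ
  choose φ hφ1 hφ0 using fun n => exists_cutoff (K n) (K.isCompact n)
  -- The family consists of cutoffs times a dense sequence of `C(Λ, ℝ)`. The index `none` keeps the
  -- bare cutoff, whose integral bounds the approximation error.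
  let g : Option ℕ → C(Λ, ℝ) := fun k => k.elim 1 (TopologicalSpace.denseSeq C(Λ, ℝ))
  let d : ℕ × Option ℕ → C_c(Λ, ℝ) := fun i =>
    ⟨(φ i.1).toContinuousMap * g i.2, (φ i.1).hasCompactSupport.mul_right⟩
  have hd (n k) (x : Λ) : d (n, k) x = φ n x * g k x := rfl
  refine ⟨d, fun X _ c hc f => ?_⟩
  obtain ⟨n, hn⟩ := K.exists_superset_of_isCompact f.hasCompactSupport
  have hφ : d (n, none) = φ n := by ext x; simp [hd, g]
  refine continuous_of_locally_uniform_approx_of_continuousAt fun x₀ u hu => ?_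
  obtain ⟨ε, hε, hεu⟩ := Metric.mem_uniformity_dist.1 hu
  -- The extra 1 makes `integral (φ n) < M` an open condition satisfied at `x₀`, so the error `ε / M
  -- * φ n` integrates to less than `ε` nearby.
  set M := (c x₀).integral (φ n) + 1 with hM
  have hM0 : 0 < M := by have := (c x₀).integral_nonneg (hφ0 n); linarith
  have hcomp : IsCompact (tsupport (φ n)) := (φ n).hasCompactSupport
  have hnhds : {h : C(Λ, ℝ) | ∀ x ∈ tsupport (φ n), dist (f x) (h x) < ε / M} ∈
      𝓝 f.toContinuousMap := by
    have := (ContinuousMap.tendsto_iff_forall_isCompact_tendstoUniformlyOn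
      (F := fun h : C(Λ, ℝ) => h) (p := 𝓝 f.toContinuousMap) (f := f.toContinuousMap)).1
      tendsto_id _ hcomp
    exact (Metric.tendstoUniformlyOn_iff.1 this) (ε / M) (div_pos hε hM0)
  obtain ⟨_, ⟨k, rfl⟩, hk⟩ := (TopologicalSpace.denseRange_denseSeq C(Λ, ℝ)).inter_nhds_nonempty
    hnhds
  have hpt (x : Λ) : |f x - d (n, some k) x| ≤ ε / M * φ n x := by
    rw [hd]
    have hf : f x = φ n x * f x := by
      by_cases hx : x ∈ tsupport f
      · rw [hφ1 n x (hn hx), one_mul]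
      · rw [image_eq_zero_of_notMem_tsupport hx, mul_zero]
    rw [hf, ← mul_sub, abs_mul, abs_of_nonneg (hφ0 n x), mul_comm (ε / M)]
    by_cases hx : x ∈ tsupport (φ n)
    · exact mul_le_mul_of_nonneg_left (hk x hx).le (hφ0 n x)
    · simp [image_eq_zero_of_notMem_tsupport hx]
  refine ⟨{x | (c x).integral (φ n) < M}, ?_, fun x => (c x).integral (d (n, some k)),
    (hc _).continuousAt, fun y hy => hεu ?_⟩
  · have := hc (n, none)
    rw [hφ] at this
    exact (isOpen_lt this continuous_const).mem_nhds (by simp [hM])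
  · calc dist ((c y).integral f) ((c y).integral (d (n, some k)))
        ≤ ε / M * (c y).integral (φ n) := (c y).abs_integral_sub_le hpt
      _ < ε / M * M := by gcongr; exact hy
      _ = ε := by field_simp

/-- An uncountable product of lines may have more Borel sets than its product σ-algebra. Countably
many integrals already induce the topology, and on a countable product of lines the two σ-algebras
agree. -/
lemma measurableSpace_eq_comap :
    instMeasurableSpace (Λ := Λ) =
      MeasurableSpace.comap evaluation MeasurableSpace.pi := by
  apply le_antisymm
  · obtain ⟨d, hd⟩ := exists_countable_family Λ
    let Ψ : Configuration Λ → ℕ × Option ℕ → ℝ := fun ω i => ω.integral (d i)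
    have hle : (TopologicalSpace.induced Ψ inferInstance : TopologicalSpace (Configuration Λ)) ≤
        (inferInstance : TopologicalSpace (Configuration Λ)) := by
      refine le_iInf fun f => continuous_iff_le_induced.1 ?_
      refine @hd (Configuration Λ) (TopologicalSpace.induced Ψ inferInstance) id (fun i => ?_) f
      exact @Continuous.comp _ _ _ (TopologicalSpace.induced Ψ inferInstance) _ _ Ψ (fun y => y i)
        (continuous_apply i) continuous_induced_dom
    calc borel (Configuration Λ)
        ≤ @borel _ (TopologicalSpace.induced Ψ inferInstance) := borel_anti hle
      _ = MeasurableSpace.comap Ψ (borel _) := borel_comap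
      _ = MeasurableSpace.comap Ψ MeasurableSpace.pi := by rw [← BorelSpace.measurable_eq]
      _ ≤ MeasurableSpace.comap evaluation MeasurableSpace.pi := by
        let π : (C_c(Λ, ℝ) → ℝ) → ℕ × Option ℕ → ℝ := fun e i => e (d i)
        have hπ : Measurable π := measurable_pi_lambda _ fun i => measurable_pi_apply _
        have : Ψ = π ∘ evaluation := rfl
        rw [this, ← MeasurableSpace.comap_comp]
        exact MeasurableSpace.comap_mono hπ.comap_le
  · refine Measurable.comap_le (measurable_pi_lambda _ fun f => ?_)
    exact (continuous_integral f).measurable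

lemma measurable_evaluation : Measurable (evaluation (Λ := Λ)) :=
  measurable_pi_lambda _ fun f => (continuous_integral f).measurable

lemma measurable_iff_integral {α : Type*} [MeasurableSpace α] {c : α → Configuration Λ} :
    Measurable c ↔ ∀ f : C_c(Λ, ℝ), Measurable fun a => (c a).integral f := by
  refine ⟨fun h f => (continuous_integral f).measurable.comp h, fun h => ?_⟩
  rw [measurableSpace_eq_comap]
  exact measurable_comap_iff.2 (measurable_pi_lambda _ h)

lemma exists_measurableSet_preimage {A : Set (Configuration Λ)} (hA : MeasurableSet A) :
    ∃ B : Set (C_c(Λ, ℝ) → ℝ), MeasurableSet B ∧ evaluation ⁻¹' B = A := by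
  rwa [measurableSpace_eq_comap] at hA

lemma ext_of_map_evaluation {μ ν : Measure (Configuration Λ)}
    (h : μ.map evaluation = ν.map evaluation) : μ = ν := by
  ext A hA
  obtain ⟨B, hB, rfl⟩ := exists_measurableSet_preimage hA
  rw [← Measure.map_apply measurable_evaluation hB, h,
    Measure.map_apply measurable_evaluation hB]

/-- If `x ∉ ω`, a bump function equal to 1 near `x` and supported away from `ω` has integral 0 at
`ω`. Configurations where this integral is below 1 have no point near `x`. -/
lemma isClosed_mem : IsClosed {p : Configuration Λ × Λ | p.2 ∈ p.1.carrier} := by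
  refine ⟨isOpen_iff_mem_nhds.2 ?_⟩
  rintro ⟨ω, x⟩ hx
  obtain ⟨L, hL, hxL⟩ := exists_compact_mem_nhds x
  have hF := ω.finite_inter L hL
  set F := ω.carrier ∩ L with hFdef
  obtain ⟨K, hK, hxK, hKV⟩ := exists_compact_subset
    (isOpen_interior.inter hF.isClosed.isOpen_compl)
    (show x ∈ interior L ∩ Fᶜ from ⟨mem_interior_iff_mem_nhds.2 hxL, fun h => hx h.1⟩)
  obtain ⟨f, hf1, hf2, hf3, hf4⟩ := exists_continuousMap_one_of_isCompact_subset_isOpen hK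
    (isOpen_interior.inter hF.isClosed.isOpen_compl) hKV
  let f' : C_c(Λ, ℝ) := ⟨f, hf2⟩
  have h0 : ω.integral f' = 0 := by
    refine finsum_mem_of_eqOn_zero fun y hy => ?_
    by_contra hne
    have := hf3 (subset_tsupport f (show y ∈ Function.support f from hne))
    exact this.2 ⟨hy, interior_subset this.1⟩
  have : {ω' : Configuration Λ | ω'.integral f' < 1} ×ˢ interior K ∈ 𝓝 (ω, x) :=
    ((isOpen_lt (continuous_integral f') continuous_const).prod isOpen_interior).mem_nhds
      ⟨by simp [h0], hxK⟩
  filter_upwards [this]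
  rintro ⟨ω', x'⟩ ⟨h1, h2⟩ h3
  have h4 := ω'.le_integral (f := f') (fun y => (hf4 y).1) h3
  have h5 : f' x' = 1 := hf1 (interior_subset h2)
  rw [h5] at h4
  exact absurd h1 (not_lt.2 h4)

variable [MeasurableSpace Λ] [BorelSpace Λ]

lemma measurableSet_mem : MeasurableSet {p : Configuration Λ × Λ | p.2 ∈ p.1.carrier} := by
  have : SecondCountableTopology Λ := inferInstance
  exact isClosed_mem.measurableSet

lemma measurable_add : Measurable fun p : Configuration Λ × Λ => p.1.add p.2 := by
  classical
  refine measurable_iff_integral.2 fun f => ?_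
  simp_rw [integral_add_point]
  exact ((continuous_integral f).measurable.comp measurable_fst).add
    (Measurable.ite measurableSet_mem measurable_const (f.continuous.measurable.comp measurable_snd))

lemma countable_carrier (ω : Configuration Λ) : ω.carrier.Countable := by
  have : ω.carrier = ⋃ n, ω.carrier ∩ compactCovering Λ n := by
    rw [← Set.inter_iUnion, iUnion_compactCovering, Set.inter_univ]
  rw [this]
  exact Set.countable_iUnion fun n => (ω.finite_inter _ (isCompact_compactCovering Λ n)).countable

lemma ae_notMem (ω : Configuration Λ) (σ : Measure Λ) [NullSingletonClass σ] :
    ∀ᵐ x ∂σ, x ∉ ω.carrier := by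
  rw [ae_iff]
  simpa using ω.countable_carrier.measure_zero σ

lemma measurableSet_singleton_empty :
    MeasurableSet {(Configuration.empty : Configuration Λ)} := by
  choose φ hφ1 hφ0 using fun n => exists_cutoff (compactCovering Λ n)
    (isCompact_compactCovering Λ n)
  have : {(Configuration.empty : Configuration Λ)} = ⋂ n, {ω | ω.integral (φ n) = 0} := by
    ext ω
    simp only [Set.mem_singleton_iff, Set.mem_iInter, Set.mem_ofPred_eq]
    refine ⟨fun h n => by simp [h, integral, Configuration.empty], fun h => ?_⟩
    have : ω.carrier = ∅ := by
      refine Set.eq_empty_of_forall_notMem fun x hx => ?_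
      obtain ⟨n, hn⟩ := exists_mem_compactCovering x
      have := ω.le_integral (hφ0 n) hx
      rw [h n, hφ1 n x hn] at this
      linarith
    cases ω
    simpa [Configuration.empty] using this
  rw [this]
  exact MeasurableSet.iInter fun n =>
    (isClosed_eq (continuous_integral _) continuous_const).measurableSet

end Measurability

end Configuration

/-! ### Laplace transforms determine laws on products of lines. -/

section Uniqueness

open ProbabilityTheory Complex in
/-- Two laws on a product of real lines agree as soon as their Laplace transforms are finite and
agree at all finite linear combinations of the coordinates. -/
lemma MeasureTheory.Measure.ext_of_integral_exp_sum {ι : Type*} {ρ ρ' : Measure (ι → ℝ)}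
    [IsProbabilityMeasure ρ] [IsProbabilityMeasure ρ']
    (hfin : ∀ (J : Finset ι) (t : J → ℝ), ∫ e, Real.exp (∑ j, t j * e j) ∂ρ ≠ 0)
    (heq : ∀ (J : Finset ι) (t : J → ℝ),
      ∫ e, Real.exp (∑ j, t j * e j) ∂ρ = ∫ e, Real.exp (∑ j, t j * e j) ∂ρ') :
    ρ = ρ' := by
  classical
  have hrestrict (J : Finset ι) : ρ.map J.restrict = ρ'.map J.restrict := by
    have : IsProbabilityMeasure (ρ.map J.restrict) :=
      Measure.isProbabilityMeasure_map (Finset.measurable_restrict J).aemeasurable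
    have : IsProbabilityMeasure (ρ'.map J.restrict) :=
      Measure.isProbabilityMeasure_map (Finset.measurable_restrict J).aemeasurable
    refine Measure.ext_of_charFunDual (funext fun L => ?_)
    let t : J → ℝ := fun j => L (Pi.single j 1)
    let X : (ι → ℝ) → ℝ := fun e => ∑ j, t j * e j
    have hL (e : ι → ℝ) : L (J.restrict e) = X e := by
      have := LinearMap.pi_apply_eq_sum_univ (L : (J → ℝ) →ₗ[ℝ] ℝ) (J.restrict e)
      refine this.trans (Finset.sum_congr rfl fun j _ => ?_)
      have hs : (fun k => if j = k then (1 : ℝ) else 0) = Pi.single j 1 := by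
        ext k
        simp [Pi.single_apply, eq_comm]
      rw [hs, smul_eq_mul, mul_comm]
      rfl
    have hmul (r : ℝ) (e : ι → ℝ) : r * X e = ∑ j, (r * t j) * e j := by
      simp [X, Finset.mul_sum, mul_assoc]
    have hmgf : mgf X ρ = mgf X ρ' := by
      ext r
      simp only [mgf, hmul]
      exact heq J fun j => r * t j
    -- A nonintegrable function has Bochner integral 0, so `hfin` yields integrability at every real
    -- parameter. The moment generating function then extends to the whole plane, and its value at
    -- `I` is the characteristic function.
    have huniv : integrableExpSet X ρ = Set.univ := by
      refine Set.eq_univ_of_forall fun r => ?_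
      by_contra hr
      refine hfin J (fun j => r * t j) ?_
      simp_rw [← hmul]
      exact integral_undef hr
    have hI := eqOn_complexMGF_of_mgf hmgf (x := I) (by simp [huniv])
    have hchar (π : Measure (ι → ℝ)) : charFunDual (π.map J.restrict) L = complexMGF X π I := by
      rw [charFunDual_apply, integral_map (Finset.measurable_restrict J).aemeasurable
        (by fun_prop), complexMGF]
      simp_rw [hL, mul_comm I]
    rw [hchar, hchar, hI]
  have : ∀ J : Finset ι, IsFiniteMeasure (ρ.map J.restrict) := fun J => inferInstance
  exact IsProjectiveLimit.unique (P := fun J => ρ.map J.restrict) (fun J => rfl)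
    fun J => (hrestrict J).symm

end Uniqueness

/-! ### Existence and uniqueness of the Poisson measure. -/

namespace Configuration

variable {Λ : Type*} [MetricSpace Λ] [SigmaCompactSpace Λ] [LocallyCompactSpace Λ]
  [MeasurableSpace Λ] [BorelSpace Λ]

lemma evaluation_sum (ω : Configuration Λ) (J : Finset C_c(Λ, ℝ)) (t : J → ℝ) :
    ∑ j, t j * ω.evaluation j = ω.integral (∑ j, t j • (j : C_c(Λ, ℝ))) := by
  rw [integral_map_sum]
  simp [integral_map_smul, evaluation]

/-- A linear combination of integrals is the integral of one test function, so the defining identity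
contains all joint Laplace transforms. -/
lemma _root_.IsPoissonMeasure.integral_exp_sum {σ : Measure Λ} {μ : Measure (Configuration Λ)}
    (hμ : IsPoissonMeasure σ μ) (J : Finset C_c(Λ, ℝ)) (t : J → ℝ) :
    ∫ e, Real.exp (∑ j, t j * e j) ∂(μ.map evaluation) =
      Real.exp (∫ x, (Real.exp ((∑ j, t j • (j : C_c(Λ, ℝ)) : C_c(Λ, ℝ)) x) - 1) ∂σ) := by
  rw [integral_map measurable_evaluation.aemeasurable (by
    refine (Measurable.exp ?_).aestronglyMeasurable
    exact Finset.measurable_sum _ fun j _ => (measurable_pi_apply _).const_mul _)]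
  simp_rw [evaluation_sum]
  exact hμ.2 _

lemma _root_.IsPoissonMeasure.unique {σ : Measure Λ} {μ ν : Measure (Configuration Λ)}
    (hμ : IsPoissonMeasure σ μ) (hν : IsPoissonMeasure σ ν) : μ = ν := by
  have := hμ.1
  have := hν.1
  have := Measure.isProbabilityMeasure_map (μ := μ) measurable_evaluation.aemeasurable
  have := Measure.isProbabilityMeasure_map (μ := ν) measurable_evaluation.aemeasurable
  refine ext_of_map_evaluation (Measure.ext_of_integral_exp_sum (fun J t => ?_) fun J t => ?_)
  · rw [hμ.integral_exp_sum]
    exact (Real.exp_pos _).ne'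
  · rw [hμ.integral_exp_sum, hν.integral_exp_sum]

/-- The law, under `σ ^ n`, of the configuration made of `n` points. -/
noncomputable def pointLaw (σ : Measure Λ) : ℕ → Measure (Configuration Λ)
  | 0 => Measure.dirac Configuration.empty
  | n + 1 => ((pointLaw σ n).prod σ).map fun p => p.1.add p.2

instance (σ : Measure Λ) [IsFiniteMeasure σ] (n : ℕ) : IsFiniteMeasure (pointLaw σ n) := by
  induction n with
  | zero => exact inferInstanceAs (IsFiniteMeasure (Measure.dirac _))
  | succ n ih => exact inferInstanceAs (IsFiniteMeasure (Measure.map _ _))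

lemma lintegral_pointLaw_succ (σ : Measure Λ) [IsFiniteMeasure σ] (n : ℕ)
    {g : Configuration Λ → ℝ≥0∞} (hg : Measurable g) :
    ∫⁻ ω, g ω ∂(pointLaw σ (n + 1)) = ∫⁻ ω, ∫⁻ x, g (ω.add x) ∂σ ∂(pointLaw σ n) := by
  rw [pointLaw, lintegral_map hg measurable_add, lintegral_prod]
  exact (hg.comp measurable_add).aemeasurable

/-- As `σ` is diffuse, a fresh point almost surely misses the earlier ones and contributes an
independent factor. -/
lemma lintegral_exp_pointLaw (σ : Measure Λ) [IsFiniteMeasure σ] [NullSingletonClass σ]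
    (f : C_c(Λ, ℝ)) (n : ℕ) :
    ∫⁻ ω, ENNReal.ofReal (Real.exp (ω.integral f)) ∂(pointLaw σ n) =
      (∫⁻ x, ENNReal.ofReal (Real.exp (f x)) ∂σ) ^ n := by
  have hm : Measurable fun ω : Configuration Λ => ENNReal.ofReal (Real.exp (ω.integral f)) :=
    (continuous_integral f).measurable.exp.ennreal_ofReal
  induction n with
  | zero =>
    rw [pointLaw, lintegral_dirac' _ hm]
    simp [integral, Configuration.empty]
  | succ n ih =>
    rw [lintegral_pointLaw_succ σ n hm, pow_succ, ← ih, ← lintegral_mul_const _ hm]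
    refine lintegral_congr fun ω => ?_
    have hf : Measurable fun x => ENNReal.ofReal (Real.exp (f x)) :=
      f.continuous.measurable.exp.ennreal_ofReal
    rw [← lintegral_const_mul _ hf]
    refine lintegral_congr_ae ?_
    filter_upwards [ω.ae_notMem σ] with x hx
    rw [integral_add_point, if_neg hx, Real.exp_add, ENNReal.ofReal_mul (Real.exp_pos _).le]

/-- The mixture of the laws of `n` independent points with Poisson weights. -/
noncomputable def poissonMixture (σ : Measure Λ) : Measure (Configuration Λ) :=
  Measure.sum fun n =>
    ENNReal.ofReal (Real.exp (-σ.real Set.univ) / n.factorial) • pointLaw σ n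

lemma lintegral_poissonMixture (σ : Measure Λ) (g : Configuration Λ → ℝ≥0∞) :
    ∫⁻ ω, g ω ∂(poissonMixture σ) = ∑' n : ℕ,
      ENNReal.ofReal (Real.exp (-σ.real Set.univ) / n.factorial) *
        ∫⁻ ω, g ω ∂(pointLaw σ n) := by
  simp [poissonMixture, lintegral_sum_measure, lintegral_smul_measure]

lemma integrable_exp (σ : Measure Λ) [IsFiniteMeasure σ] (f : C_c(Λ, ℝ)) :
    Integrable (fun x => Real.exp (f x)) σ := by
  obtain ⟨C, hC⟩ := f.hasCompactSupport.exists_bound_of_continuous f.continuous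
  refine Integrable.of_bound (C := Real.exp C)
    f.continuous.measurable.exp.aestronglyMeasurable (ae_of_all _ fun x => ?_)
  rw [Real.norm_of_nonneg (Real.exp_pos _).le]
  exact Real.exp_le_exp.2 ((le_abs_self _).trans (hC x))

lemma lintegral_exp_poissonMixture (σ : Measure Λ) [IsFiniteMeasure σ] [NullSingletonClass σ]
    (f : C_c(Λ, ℝ)) :
    ∫⁻ ω, ENNReal.ofReal (Real.exp (ω.integral f)) ∂(poissonMixture σ) =
      ENNReal.ofReal (Real.exp (∫ x, (Real.exp (f x) - 1) ∂σ)) := by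
  rw [lintegral_poissonMixture]
  set b := ∫ x, Real.exp (f x) ∂σ with hb
  have hb0 : 0 ≤ b := MeasureTheory.integral_nonneg fun x => (Real.exp_pos _).le
  have ha : ∫⁻ x, ENNReal.ofReal (Real.exp (f x)) ∂σ = ENNReal.ofReal b :=
    (ofReal_integral_eq_lintegral_ofReal (integrable_exp σ f)
      (ae_of_all _ fun x => (Real.exp_pos _).le)).symm
  simp_rw [lintegral_exp_pointLaw, ha]
  -- This is `e⁻ˢ ∑ bⁿ / n! = exp (b - s)` with `s = σ(Λ)` and `b = ∫ eᶠ dσ`.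
  have hs : HasSum (fun n : ℕ => Real.exp (-σ.real Set.univ) / n.factorial * b ^ n)
      (Real.exp (∫ x, (Real.exp (f x) - 1) ∂σ)) := by
    rw [integral_sub (integrable_exp σ f) (integrable_const 1), ← hb, integral_const,
      smul_eq_mul, mul_one, sub_eq_neg_add, Real.exp_add]
    have := (NormedSpace.expSeries_div_hasSum_exp b).mul_left (Real.exp (-σ.real Set.univ))
    rw [← Real.exp_eq_exp_ℝ] at this
    refine this.congr_fun ?_
    intro n
    ring
  rw [← hs.tsum_eq, ENNReal.ofReal_tsum_of_nonneg (fun n => by positivity) hs.summable]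
  refine tsum_congr fun n => ?_
  rw [ENNReal.ofReal_mul (by positivity), ENNReal.ofReal_pow hb0]

instance (σ : Measure Λ) [IsFiniteMeasure σ] [NullSingletonClass σ] :
    IsProbabilityMeasure (poissonMixture σ) := by
  refine ⟨?_⟩
  have := lintegral_exp_poissonMixture σ 0
  simpa [integral] using this

lemma isPoissonMeasure_poissonMixture (σ : Measure Λ) [IsFiniteMeasure σ]
    [NullSingletonClass σ] : IsPoissonMeasure σ (poissonMixture σ) := by
  refine ⟨inferInstance, fun f => ?_⟩
  rw [integral_eq_lintegral_of_nonneg_ae (ae_of_all _ fun ω => (Real.exp_pos _).le)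
    (continuous_integral f).measurable.exp.aestronglyMeasurable, lintegral_exp_poissonMixture,
    ENNReal.toReal_ofReal (Real.exp_pos _).le]

/-- `poissonMeasure` is an arbitrary choice; uniqueness makes it computable through the mixture. -/
lemma _root_.poissonMeasure_eq (σ : Measure Λ) [IsFiniteMeasure σ] [NullSingletonClass σ] :
    poissonMeasure σ = poissonMixture σ := by
  have h : ∃ μ, IsPoissonMeasure σ μ := ⟨_, isPoissonMeasure_poissonMixture σ⟩
  rw [poissonMeasure, dif_pos h]
  exact h.choose_spec.unique (isPoissonMeasure_poissonMixture σ)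

end Configuration

/-! ### The `L¹` Poincaré inequality. -/

namespace Configuration

variable {Λ : Type*} [MetricSpace Λ] [SigmaCompactSpace Λ] [LocallyCompactSpace Λ]
  [MeasurableSpace Λ] [BorelSpace Λ]

/-- The integrals of a single point. -/
def pointEvaluation (x : Λ) : C_c(Λ, ℝ) → ℝ := fun f => f x

lemma measurable_pointEvaluation : Measurable (pointEvaluation (Λ := Λ)) :=
  measurable_pi_lambda _ fun f => f.continuous.measurable

/-- Adding a point becomes a translation in a vector space, where sums exist without any
disjointness condition. -/
lemma evaluation_add_of_notMem {ω : Configuration Λ} {x : Λ} (hx : x ∉ ω.carrier) :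
    (ω.add x).evaluation = ω.evaluation + pointEvaluation x := by
  ext f
  simp [evaluation, integral_add_point, hx, pointEvaluation]

/-- The law of the integrals under the Poisson measure. -/
noncomputable def evaluationLaw (σ : Measure Λ) : Measure (C_c(Λ, ℝ) → ℝ) :=
  (poissonMixture σ).map evaluation

instance (σ : Measure Λ) [IsFiniteMeasure σ] [NullSingletonClass σ] :
    IsProbabilityMeasure (evaluationLaw σ) :=
  Measure.isProbabilityMeasure_map measurable_evaluation.aemeasurable

instance (σ τ : Measure Λ) [NullSingletonClass σ] [NullSingletonClass τ] :
    NullSingletonClass (σ + τ) := ⟨fun x => by simp⟩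

/-- Poisson measures are stable under superposition. -/
lemma evaluationLaw_add (σ τ : Measure Λ) [IsFiniteMeasure σ] [NullSingletonClass σ]
    [IsFiniteMeasure τ] [NullSingletonClass τ] :
    evaluationLaw (σ + τ) =
      ((evaluationLaw σ).prod (evaluationLaw τ)).map fun p => p.1 + p.2 := by
  have hadd : Measurable fun p : (C_c(Λ, ℝ) → ℝ) × (C_c(Λ, ℝ) → ℝ) => p.1 + p.2 :=
    measurable_fst.add measurable_snd
  have : IsProbabilityMeasure
      (((evaluationLaw σ).prod (evaluationLaw τ)).map fun p => p.1 + p.2) :=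
    Measure.isProbabilityMeasure_map hadd.aemeasurable
  have key := fun (σ : Measure Λ) [IsFiniteMeasure σ] [NullSingletonClass σ] =>
    (isPoissonMeasure_poissonMixture σ).integral_exp_sum
  refine Measure.ext_of_integral_exp_sum (fun J t => ?_) fun J t => ?_
  · rw [evaluationLaw, key]
    exact (Real.exp_pos _).ne'
  · rw [integral_map hadd.aemeasurable (by
      refine (Measurable.exp ?_).aestronglyMeasurable
      exact Finset.measurable_sum _ fun j _ => (measurable_pi_apply _).const_mul _)]
    -- By independence the Laplace transforms multiply, while the exponent `∫ (eᶠ - 1) dσ` is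
    -- additive in the intensity.
    simp only [Pi.add_apply, mul_add, Finset.sum_add_distrib, Real.exp_add]
    rw [integral_prod_mul (fun e : C_c(Λ, ℝ) → ℝ => Real.exp (∑ j, t j * e j))
      (fun e : C_c(Λ, ℝ) → ℝ => Real.exp (∑ j, t j * e j)), evaluationLaw, evaluationLaw,
      evaluationLaw, key, key, key, ← Real.exp_add, integral_add_measure]
    · exact (integrable_exp σ _).sub (integrable_const 1)
    · exact (integrable_exp τ _).sub (integrable_const 1)

lemma lintegral_evaluationLaw_add (σ τ : Measure Λ) [IsFiniteMeasure σ] [NullSingletonClass σ]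
    [IsFiniteMeasure τ] [NullSingletonClass τ] {g : (C_c(Λ, ℝ) → ℝ) → ℝ≥0∞}
    (hg : Measurable g) :
    ∫⁻ e, g e ∂(evaluationLaw (σ + τ)) =
      ∫⁻ a, ∫⁻ b, g (a + b) ∂(evaluationLaw τ) ∂(evaluationLaw σ) := by
  have hadd : Measurable fun p : (C_c(Λ, ℝ) → ℝ) × (C_c(Λ, ℝ) → ℝ) => p.1 + p.2 :=
    measurable_fst.add measurable_snd
  rw [evaluationLaw_add, lintegral_map hg hadd, lintegral_prod]
  exact (hg.comp hadd).aemeasurable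

/-- The mean absolute difference of `F` at two independent samples. -/
noncomputable def meanDifference (σ : Measure Λ) (F : (C_c(Λ, ℝ) → ℝ) → ℝ) : ℝ≥0∞ :=
  ∫⁻ a, ∫⁻ b, edist (F a) (F b) ∂(evaluationLaw σ) ∂(evaluationLaw σ)

/-- The `L¹` norm, with respect to the intensity, of the discrete gradient. -/
noncomputable def gradientNorm (σ : Measure Λ) (F : (C_c(Λ, ℝ) → ℝ) → ℝ)
    (e : C_c(Λ, ℝ) → ℝ) : ℝ≥0∞ :=
  ∫⁻ x, edist (F (e + pointEvaluation x)) (F e) ∂σ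

lemma measurable_gradientNorm (σ : Measure Λ) [IsFiniteMeasure σ]
    {F : (C_c(Λ, ℝ) → ℝ) → ℝ} (hF : Measurable F) : Measurable (gradientNorm σ F) := by
  refine Measurable.lintegral_prod_right' (f := fun p : (C_c(Λ, ℝ) → ℝ) × Λ =>
    edist (F (p.1 + pointEvaluation p.2)) (F p.1)) ?_
  have := measurable_pointEvaluation (Λ := Λ)
  fun_prop

/-- Go from `a + b` to `a' + b'` through `a' + b`. Each move resamples one summand with the other
frozen, and by symmetry both cost the same on average. -/
lemma meanDifference_add_self_le (τ : Measure Λ) [IsFiniteMeasure τ] [NullSingletonClass τ]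
    {F : (C_c(Λ, ℝ) → ℝ) → ℝ} (hF : Measurable F) :
    meanDifference (τ + τ) F ≤
      2 * ∫⁻ b, meanDifference τ (fun a => F (a + b)) ∂(evaluationLaw τ) := by
  set ρ := evaluationLaw τ with hρ
  have h1 : meanDifference (τ + τ) F = ∫⁻ a, ∫⁻ b, ∫⁻ a', ∫⁻ b',
      edist (F (a + b)) (F (a' + b')) ∂ρ ∂ρ ∂ρ ∂ρ := by
    rw [meanDifference, lintegral_evaluationLaw_add]
    · refine lintegral_congr fun a => lintegral_congr fun b => ?_
      rw [lintegral_evaluationLaw_add]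
      fun_prop
    · exact Measurable.lintegral_prod_right' (f := fun p : (C_c(Λ, ℝ) → ℝ) × (C_c(Λ, ℝ) → ℝ) =>
        edist (F p.1) (F p.2)) (by fun_prop)
  have h2 : meanDifference (τ + τ) F ≤
      (∫⁻ a, ∫⁻ b, ∫⁻ a', edist (F (a + b)) (F (a' + b)) ∂ρ ∂ρ ∂ρ) +
        ∫⁻ b, ∫⁻ a', ∫⁻ b', edist (F (a' + b)) (F (a' + b')) ∂ρ ∂ρ ∂ρ := by
    rw [h1]
    calc ∫⁻ a, ∫⁻ b, ∫⁻ a', ∫⁻ b', edist (F (a + b)) (F (a' + b')) ∂ρ ∂ρ ∂ρ ∂ρ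
        ≤ ∫⁻ a, ∫⁻ b, ∫⁻ a', ∫⁻ b', (edist (F (a + b)) (F (a' + b)) +
            edist (F (a' + b)) (F (a' + b'))) ∂ρ ∂ρ ∂ρ ∂ρ := by
          gcongr
          exact edist_triangle _ _ _
      _ = ∫⁻ a, ((∫⁻ b, ∫⁻ a', edist (F (a + b)) (F (a' + b)) ∂ρ ∂ρ) +
            ∫⁻ b, ∫⁻ a', ∫⁻ b', edist (F (a' + b)) (F (a' + b')) ∂ρ ∂ρ ∂ρ) ∂ρ := by
          refine lintegral_congr fun a => ?_
          rw [← lintegral_add_left (Measurable.lintegral_prod_right'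
            (f := fun p : (C_c(Λ, ℝ) → ℝ) × (C_c(Λ, ℝ) → ℝ) =>
              edist (F (a + p.1)) (F (p.2 + p.1))) (by fun_prop))]
          refine lintegral_congr fun b => ?_
          rw [← lintegral_add_left (by fun_prop)]
          refine lintegral_congr fun a' => ?_
          rw [lintegral_add_left (by fun_prop)]
          simp
      _ = _ := by
          rw [lintegral_add_right _ measurable_const]
          simp
  have h3 : ∫⁻ a, ∫⁻ b, ∫⁻ a', edist (F (a + b)) (F (a' + b)) ∂ρ ∂ρ ∂ρ =
      ∫⁻ b, meanDifference τ (fun a => F (a + b)) ∂ρ := by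
    refine lintegral_lintegral_swap (Measurable.aemeasurable ?_)
    exact Measurable.lintegral_prod_right'
      (f := fun p : ((C_c(Λ, ℝ) → ℝ) × (C_c(Λ, ℝ) → ℝ)) × (C_c(Λ, ℝ) → ℝ) =>
        edist (F (p.1.1 + p.1.2)) (F (p.2 + p.1.2))) (by fun_prop)
  have h4 : ∫⁻ b, ∫⁻ a', ∫⁻ b', edist (F (a' + b)) (F (a' + b')) ∂ρ ∂ρ ∂ρ =
      ∫⁻ b, meanDifference τ (fun a => F (a + b)) ∂ρ := by
    rw [lintegral_lintegral_swap]
    · refine lintegral_congr fun a' => ?_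
      simp_rw [meanDifference, add_comm _ a', ← hρ]
    · exact (Measurable.lintegral_prod_right'
        (f := fun p : ((C_c(Λ, ℝ) → ℝ) × (C_c(Λ, ℝ) → ℝ)) × (C_c(Λ, ℝ) → ℝ) =>
          edist (F (p.1.2 + p.1.1)) (F (p.1.2 + p.2))) (by fun_prop)).aemeasurable
  rw [h3, h4, ← two_mul] at h2
  exact h2

lemma pointLaw_univ (σ : Measure Λ) [IsFiniteMeasure σ] (n : ℕ) :
    pointLaw σ n Set.univ = σ Set.univ ^ n := by
  induction n with
  | zero => simp [pointLaw]
  | succ n ih =>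
    rw [pointLaw, Measure.map_apply measurable_add MeasurableSet.univ, Set.preimage_univ,
      ← Set.univ_prod_univ, Measure.prod_prod, ih, pow_succ]

/-- Both samples are compared with the empty configuration, whence the factor 2. A single point
produces a gradient at 0; several points occur with probability at most `σ(Λ)²`. -/
lemma meanDifference_le_of_bounded (σ : Measure Λ) [IsFiniteMeasure σ] [NullSingletonClass σ]
    {F : (C_c(Λ, ℝ) → ℝ) → ℝ} (hF : Measurable F) (hF1 : ∀ a b, edist (F a) (F b) ≤ 1) :
    meanDifference σ F ≤
      2 * (∫⁻ e, gradientNorm σ F e ∂(evaluationLaw σ)) + 2 * σ Set.univ ^ 2 := by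
  set w : ℕ → ℝ≥0∞ := fun n => ENNReal.ofReal (Real.exp (-σ.real Set.univ) / n.factorial) with hw
  have hone : ∑' n, w n * σ Set.univ ^ n = 1 := by
    have := lintegral_poissonMixture σ fun _ => 1
    simp only [lintegral_one, pointLaw_univ, measure_univ] at this
    exact this.symm
  have hmono (n : ℕ) : w (n + 2) ≤ w n := by
    refine ENNReal.ofReal_le_ofReal ?_
    gcongr
    omega
  have hm : Measurable fun e => edist (F e) (F 0) := by fun_prop
  have hme : Measurable fun ω : Configuration Λ => edist (F ω.evaluation) (F 0) :=
    hm.comp measurable_evaluation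
  have hdirac {g : Configuration Λ → ℝ≥0∞} (hg : Measurable g) :
      ∫⁻ ω, g ω ∂(pointLaw σ 0) = g Configuration.empty := lintegral_dirac' _ hg
  have he0 : ∫⁻ ω, edist (F ω.evaluation) (F 0) ∂(pointLaw σ 0) = 0 := by
    rw [hdirac hme, evaluation_empty, edist_self]
  have hg0 : ∫⁻ ω, gradientNorm σ F ω.evaluation ∂(pointLaw σ 0) = gradientNorm σ F 0 := by
    rw [hdirac (g := fun ω => gradientNorm σ F ω.evaluation)
      ((measurable_gradientNorm σ hF).comp measurable_evaluation), evaluation_empty]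
  have he1 : ∫⁻ ω, edist (F ω.evaluation) (F 0) ∂(pointLaw σ 1) = gradientNorm σ F 0 := by
    rw [lintegral_pointLaw_succ σ 0 hme, hdirac (Measurable.lintegral_prod_right'
      (f := fun p : Configuration Λ × Λ => edist (F (p.1.add p.2).evaluation) (F 0))
      (hme.comp measurable_add))]
    refine lintegral_congr fun x => ?_
    rw [evaluation_add_of_notMem (by simp [Configuration.empty]), evaluation_empty]
  have h0 : ∫⁻ e, edist (F e) (F 0) ∂(evaluationLaw σ) ≤
      (∫⁻ e, gradientNorm σ F e ∂(evaluationLaw σ)) + σ Set.univ ^ 2 := by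
    rw [evaluationLaw, lintegral_map hm measurable_evaluation,
      lintegral_map (measurable_gradientNorm σ hF) measurable_evaluation,
      lintegral_poissonMixture, lintegral_poissonMixture]
    rw [← Summable.sum_add_tsum_nat_add' (k := 2) ENNReal.summable, Finset.sum_range_succ, Finset.sum_range_one]
    refine add_le_add ?_ ?_
    -- Since `0! = 1!`, the one-point term on the left equals the zero-point term on the right.
    · refine le_trans ?_ (ENNReal.le_tsum 0)
      simp [he0, he1, hg0]
    · calc ∑' n, w (n + 2) * ∫⁻ ω, edist (F (evaluation ω)) (F 0) ∂(pointLaw σ (n + 2))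
          ≤ ∑' n, σ Set.univ ^ 2 * (w n * σ Set.univ ^ n) := by
            refine ENNReal.tsum_le_tsum fun n => ?_
            calc _ ≤ w n * ∫⁻ _, 1 ∂(pointLaw σ (n + 2)) := by
                  gcongr
                  · exact hmono n
                  · exact hF1 _ _
              _ = _ := by rw [lintegral_one, pointLaw_univ]; ring
        _ = σ Set.univ ^ 2 := by rw [ENNReal.tsum_mul_left, hone, mul_one]
  calc meanDifference σ F
      ≤ ∫⁻ a, ∫⁻ b, (edist (F a) (F 0) + edist (F b) (F 0)) ∂(evaluationLaw σ)
          ∂(evaluationLaw σ) := by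
        rw [meanDifference]
        gcongr
        exact edist_triangle_right _ _ _
    _ = 2 * ∫⁻ e, edist (F e) (F 0) ∂(evaluationLaw σ) := by
        simp_rw [lintegral_add_left measurable_const]
        rw [lintegral_add_right _ measurable_const]
        simp [two_mul]
    _ ≤ _ := by
        rw [← mul_add]
        gcongr

lemma gradientNorm_add_measure (σ τ : Measure Λ) (F : (C_c(Λ, ℝ) → ℝ) → ℝ)
    (e : C_c(Λ, ℝ) → ℝ) :
    gradientNorm (σ + τ) F e = gradientNorm σ F e + gradientNorm τ F e :=
  lintegral_add_measure _ _ _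

lemma gradientNorm_translate (σ : Measure Λ) (F : (C_c(Λ, ℝ) → ℝ) → ℝ)
    (a b : C_c(Λ, ℝ) → ℝ) :
    gradientNorm σ (fun e => F (e + b)) a = gradientNorm σ F (a + b) := by
  simp_rw [gradientNorm, add_right_comm]

/-- Halving the intensity doubles the number of error terms but quarters each, as the error is
quadratic in the mass. The gradient terms lose nothing, being additive in the intensity. The
induction covers all `F` because translates of `F` appear. -/
lemma meanDifference_le_add (k : ℕ) (σ : Measure Λ) [IsFiniteMeasure σ] [NullSingletonClass σ]
    {F : (C_c(Λ, ℝ) → ℝ) → ℝ} (hF : Measurable F) (hF1 : ∀ a b, edist (F a) (F b) ≤ 1) :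
    meanDifference σ F ≤ 2 * (∫⁻ e, gradientNorm σ F e ∂(evaluationLaw σ)) +
      2⁻¹ ^ k * (2 * σ Set.univ ^ 2) := by
  induction k generalizing σ F with
  | zero => simpa using meanDifference_le_of_bounded σ hF hF1
  | succ k ih =>
    obtain ⟨τ, hτ⟩ : ∃ τ : Measure Λ, τ = (2⁻¹ : ℝ≥0∞) • σ := ⟨_, rfl⟩
    have hστ : σ = τ + τ := by
      rw [hτ, ← add_smul, ENNReal.inv_two_add_inv_two, one_smul]
    have : IsFiniteMeasure τ := ⟨by
      rw [hτ, Measure.smul_apply, smul_eq_mul]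
      exact ENNReal.mul_lt_top (by simp) (measure_lt_top _ _)⟩
    have : NullSingletonClass τ := ⟨fun x => by simp [hτ]⟩
    subst hστ
    have hG := measurable_gradientNorm τ hF
    calc meanDifference (τ + τ) F
        ≤ 2 * ∫⁻ b, meanDifference τ (fun a => F (a + b)) ∂(evaluationLaw τ) :=
          meanDifference_add_self_le τ hF
      _ ≤ 2 * ∫⁻ b, (2 * (∫⁻ a, gradientNorm τ F (a + b) ∂(evaluationLaw τ)) +
            2⁻¹ ^ k * (2 * τ Set.univ ^ 2)) ∂(evaluationLaw τ) := by
          gcongr with b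
          have := ih τ (F := fun a => F (a + b)) (by fun_prop) fun a a' => hF1 _ _
          simpa only [gradientNorm_translate] using this
      _ = 2 * (2 * (∫⁻ e, gradientNorm τ F e ∂(evaluationLaw (τ + τ))) +
            2⁻¹ ^ k * (2 * τ Set.univ ^ 2)) := by
          rw [lintegral_add_right _ measurable_const, lintegral_const,
            measure_univ (μ := evaluationLaw τ), mul_one,
            lintegral_const_mul, lintegral_evaluationLaw_add _ _ hG]
          · simp_rw [add_comm]
          · exact Measurable.lintegral_prod_right'
              (f := fun p : (C_c(Λ, ℝ) → ℝ) × (C_c(Λ, ℝ) → ℝ) => gradientNorm τ F (p.2 + p.1))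
              (by fun_prop)
      _ = 2 * (∫⁻ e, gradientNorm (τ + τ) F e ∂(evaluationLaw (τ + τ))) +
            2⁻¹ ^ (k + 1) * (2 * (τ + τ) Set.univ ^ 2) := by
          simp_rw [gradientNorm_add_measure]
          rw [lintegral_add_left hG, Measure.add_apply, ← two_mul, ← two_mul, mul_add,
            pow_succ (2⁻¹ : ℝ≥0∞) k, mul_pow]
          congr 1
          have h2 : (2⁻¹ : ℝ≥0∞) * 2 = 1 := ENNReal.inv_mul_cancel (by simp) (by simp)
          calc 2 * (2⁻¹ ^ k * (2 * τ Set.univ ^ 2))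
              = 1 * (2 * (2⁻¹ ^ k * (2 * τ Set.univ ^ 2))) := (one_mul _).symm
            _ = _ := by rw [← h2]; ring

/-- The `L¹` Poincaré inequality on the Poisson space. -/
lemma meanDifference_le (σ : Measure Λ) [IsFiniteMeasure σ] [NullSingletonClass σ]
    {F : (C_c(Λ, ℝ) → ℝ) → ℝ} (hF : Measurable F) (hF1 : ∀ a b, edist (F a) (F b) ≤ 1) :
    meanDifference σ F ≤ 2 * ∫⁻ e, gradientNorm σ F e ∂(evaluationLaw σ) := by
  have hfin : 2 * σ Set.univ ^ 2 ≠ ∞ :=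
    ENNReal.mul_ne_top (by simp) (ENNReal.pow_ne_top (measure_ne_top _ _))
  have h0 : Tendsto (fun k : ℕ => (2⁻¹ : ℝ≥0∞) ^ k * (2 * σ Set.univ ^ 2)) atTop (𝓝 0) := by
    have := ENNReal.Tendsto.mul_const (b := 2 * σ Set.univ ^ 2)
      (ENNReal.tendsto_pow_atTop_nhds_zero_of_lt_one (r := 2⁻¹) (by simp)) (Or.inr hfin)
    simpa using this
  have h1 := (tendsto_const_nhds (x := 2 * ∫⁻ e, gradientNorm σ F e ∂(evaluationLaw σ))).add h0
  rw [add_zero] at h1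
  exact ge_of_tendsto' h1 fun k => meanDifference_le_add k σ hF hF1

/-! ### From functions to sets: the isoperimetric bounds. -/

lemma edist_indicator_one {α : Type*} (B : Set α) (a b : α) :
    edist (B.indicator (fun _ => (1 : ℝ)) a) (B.indicator (fun _ => (1 : ℝ)) b) =
      B.indicator 1 a * Bᶜ.indicator 1 b + Bᶜ.indicator 1 a * B.indicator 1 b := by
  by_cases ha : a ∈ B <;> by_cases hb : b ∈ B <;> simp [ha, hb, edist_dist]

lemma measure_mul_le_surfaceMeasure (σ : Measure Λ) [IsFiniteMeasure σ] [NullSingletonClass σ]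
    {A : Set (Configuration Λ)} (hA : MeasurableSet A) :
    poissonMeasure σ A * (1 - poissonMeasure σ A) ≤ surfaceMeasure σ A := by
  obtain ⟨B, hB, rfl⟩ := exists_measurableSet_preimage hA
  set F : (C_c(Λ, ℝ) → ℝ) → ℝ := B.indicator fun _ => 1 with hFdef
  have hF : Measurable F := measurable_const.indicator hB
  have hF1 (a b) : edist (F a) (F b) ≤ 1 := by
    rw [hFdef, edist_indicator_one]
    by_cases ha : a ∈ B <;> by_cases hb : b ∈ B <;> simp [ha, hb]
  -- `ω.add x` and translation by `pointEvaluation x` agree unless `x ∈ ω`, a `σ`-null event for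
  -- each `ω`.
  have hsurf : surfaceMeasure σ (evaluation ⁻¹' B) =
      ∫⁻ e, gradientNorm σ F e ∂(evaluationLaw σ) := by
    rw [surfaceMeasure, poissonMeasure_eq, evaluationLaw,
      lintegral_map (measurable_gradientNorm σ hF) measurable_evaluation]
    refine lintegral_congr fun ω => lintegral_congr_ae ?_
    filter_upwards [ω.ae_notMem σ] with x hx
    rw [← evaluation_add_of_notMem hx, edist_dist, Real.dist_eq]
    rfl
  have hp : poissonMeasure σ (evaluation ⁻¹' B) = evaluationLaw σ B := by
    rw [poissonMeasure_eq, evaluationLaw, Measure.map_apply measurable_evaluation hB]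
  have hW : meanDifference σ F = 2 * (evaluationLaw σ B * evaluationLaw σ Bᶜ) := by
    have hm1 : Measurable (B.indicator (1 : (C_c(Λ, ℝ) → ℝ) → ℝ≥0∞)) :=
      measurable_one.indicator hB
    have hm2 : Measurable (Bᶜ.indicator (1 : (C_c(Λ, ℝ) → ℝ) → ℝ≥0∞)) :=
      measurable_one.indicator hB.compl
    simp_rw [meanDifference, hFdef, edist_indicator_one]
    simp_rw [lintegral_add_left (hm2.const_mul _), lintegral_const_mul _ hm1,
      lintegral_const_mul _ hm2, lintegral_indicator_one hB, lintegral_indicator_one hB.compl]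
    rw [lintegral_add_left (hm1.mul_const _), lintegral_mul_const _ hm1,
      lintegral_mul_const _ hm2, lintegral_indicator_one hB, lintegral_indicator_one hB.compl]
    ring
  have := meanDifference_le σ hF hF1
  rw [hW, ENNReal.mul_le_mul_iff_right (by simp) (by simp), prob_compl_eq_one_sub hB] at this
  rwa [hp, hsurf]

lemma one_le_isoperimetricConstant (σ : Measure Λ) [IsFiniteMeasure σ] [NullSingletonClass σ] :
    1 ≤ isoperimetricConstant σ := by
  refine le_iInf fun A => le_iInf fun hA => le_iInf fun h0 => le_iInf fun h1 => ?_
  rw [ENNReal.le_div_iff_mul_le, one_mul]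
  · exact measure_mul_le_surfaceMeasure σ hA
  · exact Or.inl (mul_ne_zero h0.ne' (tsub_pos_of_lt h1).ne')
  · exact Or.inl (ENNReal.mul_ne_top h1.ne_top (by simp))

lemma add_ne_empty (ω : Configuration Λ) (x : Λ) : ω.add x ≠ Configuration.empty := fun h => by
  have : x ∈ (ω.add x).carrier := Set.mem_insert _ _
  rw [h] at this
  exact this

lemma poissonMeasure_singleton_empty (σ : Measure Λ) [IsFiniteMeasure σ]
    [NullSingletonClass σ] :
    poissonMeasure σ {Configuration.empty} = ENNReal.ofReal (Real.exp (-σ.real Set.univ)) := by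
  rw [poissonMeasure_eq, ← lintegral_indicator_one measurableSet_singleton_empty,
    lintegral_poissonMixture, tsum_eq_single 0]
  · rw [lintegral_indicator_one measurableSet_singleton_empty, pointLaw,
      Measure.dirac_apply' _ measurableSet_singleton_empty]
    simp
  · intro n hn
    obtain ⟨n, rfl⟩ := Nat.exists_eq_succ_of_ne_zero hn
    rw [lintegral_pointLaw_succ _ _ (measurable_one.indicator measurableSet_singleton_empty)]
    simp [add_ne_empty]

/-- Adding a point always destroys emptiness and never creates it: the gradient has modulus 1 at the
empty configuration and vanishes elsewhere. -/
lemma surfaceMeasure_singleton_empty (σ : Measure Λ) [IsFiniteMeasure σ]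
    [NullSingletonClass σ] :
    surfaceMeasure σ {Configuration.empty} =
      σ Set.univ * poissonMeasure σ {Configuration.empty} := by
  rw [surfaceMeasure, ← lintegral_indicator_const measurableSet_singleton_empty]
  refine lintegral_congr fun ω => ?_
  by_cases h : ω = Configuration.empty <;> simp [discreteGradient, add_ne_empty, h]

lemma isoperimetricConstant_le (σ : Measure Λ) [IsFiniteMeasure σ] [NullSingletonClass σ]
    (hσ : σ ≠ 0) :
    isoperimetricConstant σ ≤
      ENNReal.ofReal (σ.real Set.univ / (1 - Real.exp (-σ.real Set.univ))) := by
  have hs : 0 < σ.real Set.univ :=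
    ENNReal.toReal_pos (Measure.measure_univ_ne_zero.2 hσ) (measure_ne_top _ _)
  have hexp : Real.exp (-σ.real Set.univ) < 1 := Real.exp_lt_one_iff.2 (by linarith)
  have hp := poissonMeasure_singleton_empty σ
  have h0 : 0 < poissonMeasure σ {Configuration.empty} := by
    rw [hp]; exact ENNReal.ofReal_pos.2 (Real.exp_pos _)
  have h1 : poissonMeasure σ {Configuration.empty} < 1 := by
    rw [hp]; exact ENNReal.ofReal_lt_one.2 hexp
  have hle : isoperimetricConstant σ ≤ surfaceMeasure σ {Configuration.empty} /
      (poissonMeasure σ {Configuration.empty} * (1 - poissonMeasure σ {Configuration.empty})) :=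
    iInf₂_le_of_le _ measurableSet_singleton_empty (iInf₂_le h0 h1)
  refine hle.trans (le_of_eq ?_)
  rw [surfaceMeasure_singleton_empty, mul_comm (σ Set.univ),
    ENNReal.mul_div_mul_left _ _ h0.ne' h1.ne_top, hp, ENNReal.ofReal_div_of_pos (by linarith),
    ofReal_measureReal, ENNReal.ofReal_sub _ (Real.exp_pos _).le, ENNReal.ofReal_one]

/-- The quotient is the inverse of the slope at 0 of `1 - e⁻ˢ`, whose derivative there is 1. -/
lemma tendsto_div_one_sub_exp_neg :
    Tendsto (fun s : ℝ => s / (1 - Real.exp (-s))) (𝓝[>] 0) (𝓝 1) := by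
  have h : HasDerivAt (fun s : ℝ => 1 - Real.exp (-s)) 1 0 := by
    simpa using ((hasDerivAt_neg (0 : ℝ)).exp).const_sub 1
  have h1 := (hasDerivAt_iff_tendsto_slope.1 h).mono_left
    (nhdsWithin_mono (0 : ℝ) (fun s (hs : 0 < s) => hs.ne'))
  have h2 := h1.inv₀ one_ne_zero
  rw [inv_one] at h2
  refine h2.congr fun s => ?_
  simp [slope_def_field]

end Configuration

theorem proposition4p6 {Λ : Type*} [MetricSpace Λ] [SigmaCompactSpace Λ] [LocallyCompactSpace Λ]
    [MeasurableSpace Λ] [BorelSpace Λ] :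
    (∀ (σ : Measure Λ) [IsFiniteMeasure σ] [NullSingletonClass σ], σ ≠ 0 →
      1 ≤ isoperimetricConstant σ ∧
      isoperimetricConstant σ ≤
        ENNReal.ofReal (σ.real Set.univ / (1 - Real.exp (-σ.real Set.univ)))) ∧
    Tendsto (fun σ : FiniteMeasure Λ => isoperimetricConstant (σ : Measure Λ))
      (comap (fun σ : FiniteMeasure Λ => σ.mass) (𝓝[>] 0) ⊓
        𝓟 {σ : FiniteMeasure Λ | NullSingletonClass (σ : Measure Λ)})
      (𝓝 1) := by
  refine ⟨fun σ _ _ hσ => ⟨Configuration.one_le_isoperimetricConstant σ, Configuration.isoperimetricConstant_le σ hσ⟩, ?_⟩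
  have hcast : Tendsto (fun s : NNReal => (s : ℝ)) (𝓝[>] 0) (𝓝[>] 0) := by
    refine tendsto_nhdsWithin_iff.2 ⟨?_, ?_⟩
    · exact (NNReal.continuous_coe.tendsto' 0 0 NNReal.coe_zero).mono_left nhdsWithin_le_nhds
    · filter_upwards [self_mem_nhdsWithin] with s hs
      exact NNReal.coe_pos.2 hs
  have hupper : Tendsto (fun σ : FiniteMeasure Λ => ENNReal.ofReal
      ((σ.mass : ℝ) / (1 - Real.exp (-(σ.mass : ℝ)))))
      (comap (fun σ : FiniteMeasure Λ => σ.mass) (𝓝[>] 0) ⊓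
        𝓟 {σ : FiniteMeasure Λ | NullSingletonClass (σ : Measure Λ)}) (𝓝 1) := by
    have := ENNReal.tendsto_ofReal (Configuration.tendsto_div_one_sub_exp_neg.comp hcast)
    rw [ENNReal.ofReal_one] at this
    exact (this.comp tendsto_comap).mono_left inf_le_left
  have hdiffuse : ∀ᶠ σ : FiniteMeasure Λ in
      comap (fun σ : FiniteMeasure Λ => σ.mass) (𝓝[>] 0) ⊓
        𝓟 {σ : FiniteMeasure Λ | NullSingletonClass (σ : Measure Λ)},
      NullSingletonClass (σ : Measure Λ) :=
    mem_inf_of_right (mem_principal_self _)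
  have hpos : ∀ᶠ σ : FiniteMeasure Λ in
      comap (fun σ : FiniteMeasure Λ => σ.mass) (𝓝[>] 0) ⊓
        𝓟 {σ : FiniteMeasure Λ | NullSingletonClass (σ : Measure Λ)}, 0 < σ.mass :=
    mem_inf_of_left (tendsto_comap self_mem_nhdsWithin)
  -- Squeeze; positive mass serves only the upper bound, which requires `σ ≠ 0`.
  refine tendsto_of_tendsto_of_tendsto_of_le_of_le' tendsto_const_nhds hupper ?_ ?_
  · filter_upwards [hdiffuse] with σ hσ
    exact Configuration.one_le_isoperimetricConstant _
  · filter_upwards [hdiffuse, hpos] with σ hσ h0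
    refine Configuration.isoperimetricConstant_le _ fun h => h0.ne' ?_
    simp [FiniteMeasure.mass, h]
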